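/- Let $n\neq 6$ be a positive integer, let $G=S_n$, let $\mathcal K(G)$ be the set of conjugacy classes of $G$, and let $F$ be a field. Let $r=(r_C)_{C\in\mathcal K(G)}$ be a ramification of $G$, i.e. a family of non-negative integers, and put $\mathcal K_r(G)=\{C : r_C\neq 0\}$ and $I_C(r)=\{1,\dots,r_C\}$. For a group $H$ let $\widehat H$ be the set of homomorphisms $H\to F^\times$, and let $Z_x$ be the centralizer of $x$ in $G$. A ramification system with characters with ramification $r$ is a pair $(\vec\chi,u)$, where $u:\mathcal K(G)\to G$ satisfies $u(C)\in C$ for all $C$, and $\vec\chi=\{\chi_C^{(i)}\}_{C\in\mathcal K_r(G),\,i\in I_C(r)}$ with $\chi_C^{(i)}\in\widehat{Z_{u(C)}}$. Two such systems $(\vec\chi,u)$ and $(\vec\chi',u')$ are isomorphic if there are an automorphism $\phi$ of $G$, elements $h_C\in G$ for $C\in\mathcal K(G)$, and bijections $\phi_C:I_C(r)\to I_{\phi(C)}(r)$ for $C\in\mathcal K_r(G)$, such that $\phi(h_Cu(C)h_C^{-1})=u'(\phi(C))$ for all $C\in\mathcal K(G)$, and $\chi'^{(\phi_C(i))}_{\phi(C)}(\phi(h_Chh_C^{-1}))=\chi_C^{(i)}(h)$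 for all $C\in\mathcal K_r(G)$, $i\in I_C(r)$ and $h\in Z_{u(C)}$. Let $\mathcal N(G,r)$ be the number of isomorphism classes of ramification systems with characters with ramification $r$. For a class $C$ of permutations of cycle type $1^{\lambda_1}2^{\lambda_2}\cdots n^{\lambda_n}$ put $\gamma_C=\prod_{\lambda_i=1}i\cdot\prod_{\lambda_i\ge 2}2i$. Suppose that for every $C\in\mathcal K_r(G)$, of cycle type $1^{\lambda_1}\cdots n^{\lambda_n}$, the field $F$ contains a primitive $i$-th root of unity for every $i$ with $\lambda_i\ge 1$, and $-1\neq 1$ in $F$ if some $\lambda_i\ge 2$. (This holds for instance if $F$ contains a primitive $n!$-th root of unity.) Then $|\widehat{Z_\sigma}|=\gamma_C$ for all $C\in\mathcal K_r(G)$ and $\sigma\in C$, and $$\mathcal N(G,r)=\prod_{C\in\mathcal K_r(G)}\binom{\gamma_C+r_C-1}{r_C}.$$ -/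

import Mathlib

/-- A ramification (datum) of `G`: a formal sum of conjugacy classes with coefficients in `ℕ`.
The index set `I_C(r)` with `r C` elements is taken to be `Fin (r C)`, and
`K_r(G)` consists of the classes `C` with `r C ≠ 0`. -/
abbrev Ramification (G : Type*) [Group G] : Type _ := ConjClasses G → ℕ

/-- The characters of the one-dimensional representations of a group `H` over the field `F`. -/
abbrev LinChar (F : Type*) [Field F] (H : Type*) [Group H] : Type _ := H →* Fˣ

/-- The ramification systems with characters over `G` whose ramification is `r`: a choice `u` of an
element in every conjugacy class, and for every class `C` a family, indexed by `I_C(r)`, of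
characters of the centralizer of `u C` (for `r C = 0` the index set is empty, so that this is a
family over the classes in `K_r(G)` only). -/
structure RSC (F : Type*) [Field F] {G : Type*} [Group G] (r : Ramification G) where
  u : ConjClasses G → G
  u_mem : ∀ C, u C ∈ C.carrier
  χ : ∀ C, Fin (r C) → LinChar F (Subgroup.centralizer {u C})

/-- The conjugacy class `φ(C)`. -/
abbrev mapClass {G G' : Type*} [Group G] [Group G'] (φ : G ≃* G') (C : ConjClasses G) :
    ConjClasses G' := ConjClasses.map φ.toMonoidHom C

theorem conj_mem_centralizer {G G' : Type*} [Group G] [Group G'] (φ : G ≃* G') {g v : G} {v' : G'}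
    (e : φ (g * v * g⁻¹) = v') {x : G} (hx : x ∈ Subgroup.centralizer {v}) :
    φ (g * x * g⁻¹) ∈ Subgroup.centralizer {v'} := by
  rw [Subgroup.mem_centralizer_singleton_iff] at hx ⊢
  rw [← e, ← map_mul, ← map_mul]
  congr 1
  have h1 : g * x * g⁻¹ * (g * v * g⁻¹) = g * (x * v) * g⁻¹ := by group
  have h2 : g * v * g⁻¹ * (g * x * g⁻¹) = g * (v * x) * g⁻¹ := by group
  rw [h1, h2, hx]

namespace RSC

/-- Isomorphism of ramification systems with characters. -/
def Iso {F : Type*} [Field F] {G G' : Type*} [Group G] [Group G'] {r : Ramification G}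
    {r' : Ramification G'} (R : RSC F r) (R' : RSC F r') : Prop :=
  ∃ (φ : G ≃* G') (h : ConjClasses G → G)
    (hu : ∀ C, φ (h C * R.u C * (h C)⁻¹) = R'.u (mapClass φ C)),
    ∀ C, r C ≠ 0 → ∃ σ : Fin (r C) ≃ Fin (r' (mapClass φ C)),
      ∀ (i : Fin (r C)) (x : Subgroup.centralizer {R.u C}),
        R'.χ (mapClass φ C) (σ i)
          ⟨φ (h C * (x : G) * (h C)⁻¹), conj_mem_centralizer φ (hu C) x.2⟩ = R.χ C i x

theorem iso_iff {F : Type*} [Field F] {G G' : Type*} [Group G] [Group G'] {r : Ramification G}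
    {r' : Ramification G'} (R : RSC F r) (R' : RSC F r') :
    Iso R R' ↔ ∃ (φ : G ≃* G') (h : ConjClasses G → G),
      (∀ C C', C' = mapClass φ C → φ (h C * R.u C * (h C)⁻¹) = R'.u C') ∧
      ∀ C C', C' = mapClass φ C → r C ≠ 0 → ∃ σ : Fin (r C) ≃ Fin (r' C'),
        ∀ (i : Fin (r C)) (x : Subgroup.centralizer {R.u C})
          (y : Subgroup.centralizer {R'.u C'}), (y : G') = φ (h C * (x : G) * (h C)⁻¹) →
          R'.χ C' (σ i) y = R.χ C i x := by
  constructor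
  · rintro ⟨φ, h, hu, H⟩
    refine ⟨φ, h, ?_, ?_⟩
    · rintro C _ rfl
      exact hu C
    · rintro C _ rfl hC
      obtain ⟨σ, hσ⟩ := H C hC
      refine ⟨σ, fun i x y hy => ?_⟩
      rw [← hσ i x]
      congr 1
      exact Subtype.ext hy
  · rintro ⟨φ, h, hu, H⟩
    refine ⟨φ, h, fun C => hu C _ rfl, fun C hC => ?_⟩
    obtain ⟨σ, hσ⟩ := H C _ rfl hC
    exact ⟨σ, fun i x => hσ i x _ rfl⟩

theorem mapClass_refl {G : Type*} [Group G] (C : ConjClasses G) :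
    mapClass (MulEquiv.refl G) C = C := by
  obtain ⟨x, rfl⟩ := ConjClasses.exists_rep C
  rfl

theorem mapClass_trans {G G' G'' : Type*} [Group G] [Group G'] [Group G''] (φ : G ≃* G')
    (ψ : G' ≃* G'') (C : ConjClasses G) :
    mapClass (φ.trans ψ) C = mapClass ψ (mapClass φ C) := by
  obtain ⟨x, rfl⟩ := ConjClasses.exists_rep C
  rfl

theorem mapClass_symm_apply {G G' : Type*} [Group G] [Group G'] (φ : G ≃* G')
    (C : ConjClasses G) : mapClass φ.symm (mapClass φ C) = C := by
  rw [← mapClass_trans, MulEquiv.self_trans_symm, mapClass_refl]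

theorem mapClass_apply_symm {G G' : Type*} [Group G] [Group G'] (φ : G ≃* G')
    (C : ConjClasses G') : mapClass φ (mapClass φ.symm C) = C := by
  rw [← mapClass_trans, MulEquiv.symm_trans_self, mapClass_refl]

theorem Iso.refl {F : Type*} [Field F] {G : Type*} [Group G] {r : Ramification G}
    (R : RSC F r) : Iso R R := by
  rw [iso_iff]
  refine ⟨MulEquiv.refl G, fun _ => 1, ?_, ?_⟩
  · rintro C C' rfl
    simp [mapClass_refl]
  · intro C C' e hC
    rw [mapClass_refl] at e
    subst e
    refine ⟨Equiv.refl _, fun i x y hy => ?_⟩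
    have : y = x := Subtype.ext (by simpa using hy)
    rw [this]
    rfl

theorem Iso.trans {F : Type*} [Field F] {G G' G'' : Type*} [Group G] [Group G'] [Group G'']
    {r : Ramification G} {r' : Ramification G'} {r'' : Ramification G''} {R : RSC F r}
    {R' : RSC F r'} {R'' : RSC F r''} (h₁ : Iso R R') (h₂ : Iso R' R'') : Iso R R'' := by
  rw [iso_iff] at *
  obtain ⟨φ, g, hu, H⟩ := h₁
  obtain ⟨ψ, k, hv, K⟩ := h₂
  have key : ∀ (C : ConjClasses G) (x : G),
      (φ.trans ψ) (φ.symm (k (mapClass φ C)) * g C * x * (φ.symm (k (mapClass φ C)) * g C)⁻¹) =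
        ψ (k (mapClass φ C) * φ (g C * x * (g C)⁻¹) * (k (mapClass φ C))⁻¹) := by
    intro C x
    simp [mul_assoc]
  refine ⟨φ.trans ψ, fun C => φ.symm (k (mapClass φ C)) * g C, ?_, ?_⟩
  · intro C C'' e
    rw [mapClass_trans] at e
    rw [key, hu C _ rfl, hv _ _ e]
  · intro C C'' e hC
    rw [mapClass_trans] at e
    obtain ⟨σ, hσ⟩ := H C _ rfl hC
    have hC' : r' (mapClass φ C) ≠ 0 := by
      rwa [← Fin.equiv_iff_eq.mp ⟨σ⟩]
    obtain ⟨τ, hτ⟩ := K _ _ e hC'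
    refine ⟨σ.trans τ, fun i x z hz => ?_⟩
    rw [key] at hz
    exact (hτ (σ i) ⟨_, conj_mem_centralizer φ (hu C _ rfl) x.2⟩ z hz).trans (hσ i x _ rfl)

theorem Iso.symm {F : Type*} [Field F] {G : Type*} [Group G] [Finite G] {r : Ramification G}
    {R R' : RSC F r} (h₁ : Iso R R') : Iso R' R := by
  rw [iso_iff] at *
  obtain ⟨φ, g, hu, H⟩ := h₁
  have hr : ∀ C, r C ≠ 0 → r C = r (mapClass φ C) := fun C hC => by
    obtain ⟨σ, -⟩ := H C _ rfl hC
    exact Fin.equiv_iff_eq.mp ⟨σ⟩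
  have : Finite (ConjClasses G) := Quotient.finite _
  have hsurj : Function.Surjective
      (fun C : {C : ConjClasses G // r C ≠ 0} =>
        (⟨mapClass φ C.1, by rw [← hr C.1 C.2]; exact C.2⟩ : {C : ConjClasses G // r C ≠ 0})) := by
    apply Finite.surjective_of_injective
    intro C D e
    have e' : mapClass φ C.1 = mapClass φ D.1 := congrArg Subtype.val e
    apply Subtype.ext
    rw [← mapClass_symm_apply φ C.1, e', mapClass_symm_apply]
  refine ⟨φ.symm, fun C' => (φ (g (mapClass φ.symm C')))⁻¹, ?_, ?_⟩
  · rintro C' C rfl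
    rw [← hu _ C' (mapClass_apply_symm φ C').symm]
    simp [mul_assoc]
  · rintro C' C rfl hC'
    obtain ⟨⟨D, hD⟩, e⟩ := hsurj ⟨C', hC'⟩
    have e' : mapClass φ D = C' := congrArg Subtype.val e
    have hC : r (mapClass φ.symm C') ≠ 0 := by
      rw [← e', mapClass_symm_apply]
      exact hD
    obtain ⟨σ, hσ⟩ := H _ C' (mapClass_apply_symm φ C').symm hC
    refine ⟨σ.symm, fun i x y hy => ?_⟩
    rw [← hσ (σ.symm i) y x (by rw [hy]; simp [mul_assoc]), Equiv.apply_symm_apply]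

/-- Isomorphism is an equivalence relation on the systems with a given ramification. -/
def isoSetoid (F : Type*) [Field F] {G : Type*} [Group G] [Finite G] (r : Ramification G) :
    Setoid (RSC F r) where
  r := Iso
  iseqv := ⟨Iso.refl, Iso.symm, Iso.trans⟩

/-- The number of isomorphism classes of ramification systems with characters over `G`
with ramification `r`. -/
noncomputable def numClasses (F : Type*) [Field F] {G : Type*} [Group G] [Finite G]
    (r : Ramification G) : ℕ := Nat.card (Quotient (isoSetoid F r))

end RSC

/-- The number `λ_i` of cycles of length `i` (fixed points are the cycles of length `1`) of the
permutations in the conjugacy class `C`. -/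
def cycleCount {n : ℕ} (C : ConjClasses (Equiv.Perm (Fin n))) (i : ℕ) : ℕ :=
  Quotient.liftOn C (fun σ : Equiv.Perm (Fin n) => σ.partition.parts.count i)
    (fun _ _ h => by
      rw [Equiv.Perm.partition_eq_of_isConj.mp h])

/-- `γ_C = ∏_{λ_i = 1} i · ∏_{λ_i ≥ 2} 2 i`. -/
def gammaClass {n : ℕ} (C : ConjClasses (Equiv.Perm (Fin n))) : ℕ :=
  (∏ i ∈ Finset.Icc 1 n with cycleCount C i = 1, i) *
    ∏ i ∈ Finset.Icc 1 n with 2 ≤ cycleCount C i, 2 * i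

/-! For `n ≠ 6` every automorphism of `S_n` is inner (`Equiv.Perm.exists_eq_conj`), so it fixes
every conjugacy class. Conjugating, any system can be given a prescribed choice `u` of
representatives. An isomorphism between two systems with the same `u` acts on each centralizer by
conjugation with one of its own elements, which no character into a commutative group detects. Only
reindexing remains: an isomorphism class is a multiset of `r C` characters for each `C`
(`RSC.numClasses_eq_card_pi_sym`), and stars and bars gives the binomials.

The number of characters comes from the structure of the centralizer: it is the product over `i` of
the wreath products of a cyclic group of order `i` with `S_{λ_i}`. A character of such a factor
amounts to one of the cyclic group (`i` choices) and one of `S_{λ_i}` (trivial or sign, hence two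
choices when `λ_i ≥ 2`). The product of these numbers is `γ_C` (`card_linChar_centralizer`). -/

/-! ### Isomorphism classes as families of multisets of characters -/

theorem exists_perm_comp_eq_of_map_univ_eq {ι X : Type*} [Fintype ι] {f g : ι → X}
    (h : Multiset.map f Finset.univ.val = Multiset.map g Finset.univ.val) :
    ∃ σ : ι ≃ ι, ∀ i, g (σ i) = f i := by
  classical
  have key : ∀ x, Nonempty ({i // f i = x} ≃ {i // g i = x}) := fun x => by
    rw [← Fintype.card_eq, Fintype.card_subtype, Fintype.card_subtype]
    have := congrArg (Multiset.count x) h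
    rw [Multiset.count_map, Multiset.count_map] at this
    simpa only [Finset.card_def, Finset.filter_val, eq_comm] using this
  exact ⟨Equiv.ofFiberEquiv fun x => (key x).some, fun i => Equiv.ofFiberEquiv_map _ i⟩

theorem map_univ_eq_of_perm {ι X : Type*} [Fintype ι] {f g : ι → X} (σ : ι ≃ ι)
    (h : ∀ i, g (σ i) = f i) :
    Multiset.map f Finset.univ.val = Multiset.map g Finset.univ.val := by
  rw [show f = g ∘ σ from funext fun i => (h i).symm, ← Multiset.map_map,
    Multiset.map_univ_val_equiv]

/-- Both targets are the quotient of `A` by the same kernel. This avoids constructing a map between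
isomorphism classes and multisets. -/
theorem Nat.card_eq_of_surjective_of_eq_iff {A B C : Type*} {f : A → B} {g : A → C}
    (hf : f.Surjective) (hg : g.Surjective) (h : ∀ a b, f a = f b ↔ g a = g b) :
    Nat.card B = Nat.card C := by
  have e1 := Nat.card_congr (Setoid.quotientKerEquivOfSurjective f hf)
  have e2 := Nat.card_congr (Setoid.quotientKerEquivOfSurjective g hg)
  have : Setoid.ker f = Setoid.ker g := Setoid.ext fun a b => h a b
  rw [← e1, ← e2, this]

namespace RSC

theorem numClasses_eq_card_pi_sym {F : Type*} [Field F] {G : Type*} [Group G] [Finite G]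
    (hG : ∀ φ : G ≃* G, ∃ g, ∀ x, φ x = g * x * g⁻¹) (r : Ramification G)
    (u : ConjClasses G → G) (hu : ∀ C, u C ∈ C.carrier) :
    numClasses F r =
      Nat.card (∀ C, Sym (LinChar F (Subgroup.centralizer {u C})) (r C)) := by
  have hmap : ∀ (φ : G ≃* G) (C : ConjClasses G), mapClass φ C = C := fun φ C => by
    obtain ⟨g, hg⟩ := hG φ
    obtain ⟨x, rfl⟩ := ConjClasses.exists_rep C
    exact ConjClasses.mk_eq_mk_iff_isConj.mpr (isConj_iff.mpr ⟨g, (hg x).symm⟩).symm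
  let A := ∀ C, Fin (r C) → LinChar F (Subgroup.centralizer {u C})
  let f : A → Quotient (isoSetoid F r) := fun χ => ⟦⟨u, hu, χ⟩⟧
  let g : A → ∀ C, Sym (LinChar F (Subgroup.centralizer {u C})) (r C) :=
    fun χ C => ⟨Multiset.map (χ C) Finset.univ.val, by simp⟩
  refine Nat.card_eq_of_surjective_of_eq_iff (f := f) (g := g) ?_ ?_ ?_
  · intro q
    obtain ⟨R, rfl⟩ := Quotient.exists_rep q
    have hc : ∀ C, ∃ k : G, k * u C * k⁻¹ = R.u C := fun C =>
      isConj_iff.mp (ConjClasses.mk_eq_mk_iff_isConj.mp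
        ((ConjClasses.mem_carrier_iff_mk_eq.mp (hu C)).trans
          (ConjClasses.mem_carrier_iff_mk_eq.mp (R.u_mem C)).symm))
    choose k hk using hc
    -- Pull the characters of `R` back along conjugation by `k C`, which carries `u C` to `R.u C`.
    refine ⟨fun C i =>
      { toFun := fun x => R.χ C i ⟨k C * x * (k C)⁻¹,
          conj_mem_centralizer (MulEquiv.refl G) (hk C) x.2⟩
        map_one' := by
          rw [← map_one (R.χ C i)]
          congr 1
          exact Subtype.ext (by simp)
        map_mul' := fun x y => by
          rw [← map_mul]
          congr 1
          exact Subtype.ext (by simp) }, Quotient.sound ?_⟩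
    change Iso _ _
    rw [iso_iff]
    refine ⟨MulEquiv.refl G, k, ?_, ?_⟩
    · rintro C _ rfl
      rw [mapClass_refl]
      exact hk C
    · intro C C' e hC
      rw [mapClass_refl] at e
      subst e
      refine ⟨Equiv.refl _, fun i x y hy => ?_⟩
      change _ = R.χ C' i _
      congr 1
      exact Subtype.ext hy
  · intro s
    have : ∀ C, ∃ t : Fin (r C) → LinChar F (Subgroup.centralizer {u C}),
        Multiset.map t Finset.univ.val = (s C).1 := fun C => by
      obtain ⟨l, hl⟩ := Quotient.exists_rep (s C).1
      have hlen : l.length = r C := by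
        rw [← Multiset.coe_card]
        exact (congrArg Multiset.card hl).trans (s C).2
      refine ⟨fun i => l.get (Fin.cast hlen.symm i), ?_⟩
      rw [← hl, Fin.univ_val_map]
      refine congrArg _ (List.ext_get (by simp [hlen]) fun i h1 h2 => by simp)
    choose t ht using this
    exact ⟨t, funext fun C => Subtype.ext (ht C)⟩
  · intro χ χ'
    have e1 : f χ = f χ' ↔ Iso (⟨u, hu, χ⟩ : RSC F r) ⟨u, hu, χ'⟩ := Quotient.eq
    have e2 : g χ = g χ' ↔
        ∀ C, Multiset.map (χ C) Finset.univ.val = Multiset.map (χ' C) Finset.univ.val := by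
      rw [funext_iff]
      exact forall_congr' fun C => Subtype.ext_iff
    rw [e1, e2, iso_iff]
    constructor
    · rintro ⟨φ, h, hh, H⟩ C
      -- Isomorphisms give no bijection on classes with `r C = 0`, but there both multisets are
      -- empty.
      rcases eq_or_ne (r C) 0 with hC | hC
      · have : IsEmpty (Fin (r C)) := by rw [hC]; infer_instance
        simp
      obtain ⟨σ, hσ⟩ := H C C (hmap φ C).symm hC
      have hk := hh C C (hmap φ C).symm
      obtain ⟨k, hkφ⟩ := hG φ
      refine map_univ_eq_of_perm σ fun i => MonoidHom.ext fun x => ?_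
      -- `φ` after conjugation by `h C` is conjugation by `k * h C`, and it fixes `u C`.
      have hz : k * h C ∈ Subgroup.centralizer {u C} := by
        rw [Subgroup.mem_centralizer_singleton_iff, ← mul_inv_eq_iff_eq_mul]
        rw [hkφ] at hk
        simpa [mul_assoc] using hk
      let z : Subgroup.centralizer {u C} := ⟨k * h C, hz⟩
      have := hσ i x (z * x * z⁻¹) (by rw [hkφ]; simp [z, mul_assoc])
      rw [← this]
      change χ' C (σ i) x = χ' C (σ i) _
      rw [map_mul, map_mul, map_inv, mul_right_comm, mul_inv_cancel, one_mul]
    · intro H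
      refine ⟨MulEquiv.refl G, fun _ => 1, ?_, ?_⟩
      · rintro C _ rfl
        simp [mapClass_refl]
      · intro C C' e hC
        rw [mapClass_refl] at e
        subst e
        obtain ⟨σ, hσ⟩ := exists_perm_comp_eq_of_map_univ_eq (H C')
        refine ⟨σ, fun i x y hy => ?_⟩
        have : y = x := Subtype.ext (by simpa using hy)
        rw [this]
        exact DFunLike.congr_fun (hσ i) x

end RSC

/-! ### Automorphisms of the symmetric group are inner -/

namespace Equiv.Perm

/-- The two sides are the centralizer orders of a product of `k` disjoint transpositions and of one
transposition. With `k = j + 1`, cancelling gives `2 ^ j * (j + 1)! = (n - 2).choose (2 * j) * (2 *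
j)!`. For `j ≥ 3` the right side is too large; `j = 1, 2` are checked by hand. -/
theorem eq_one_of_two_pow_mul_factorial_eq {n k : ℕ} (hn : n ≠ 6) (hk : 1 ≤ k) (hkn : 2 * k ≤ n)
    (h : (n - 2 * k).factorial * 2 ^ k * k.factorial = (n - 2).factorial * 2) : k = 1 := by
  obtain ⟨j, rfl⟩ : ∃ j, k = j + 1 := ⟨k - 1, by omega⟩
  have h1 : (n - 2).choose (2 * j) * (2 * j).factorial * (n - 2 * (j + 1)).factorial =
      (n - 2).factorial := by
    have := Nat.choose_mul_factorial_mul_factorial (n := n - 2) (k := 2 * j) (by omega)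
    rwa [show n - 2 - 2 * j = n - 2 * (j + 1) by omega] at this
  have h2 : 2 ^ j * (j + 1).factorial = (n - 2).choose (2 * j) * (2 * j).factorial := by
    have hpos := Nat.factorial_pos (n - 2 * (j + 1))
    rw [← h1, pow_succ] at h
    nlinarith
  have hc : 1 ≤ (n - 2).choose (2 * j) := Nat.choose_pos (by omega)
  have hbig : ∀ i : ℕ, 2 ^ (i + 3) * (i + 4).factorial < (2 * (i + 3)).factorial := by
    intro i
    induction i with
    | zero => decide
    | succ i ih =>
      have f1 : (2 * (i + 1 + 3)).factorial =
          (2 * (i + 3) + 2) * ((2 * (i + 3) + 1) * (2 * (i + 3)).factorial) := by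
        rw [← Nat.factorial_succ, ← Nat.factorial_succ]
        rfl
      have f2 : (i + 1 + 4).factorial = (i + 5) * (i + 4).factorial := by
        rw [← Nat.factorial_succ]
      rw [f1, f2, show i + 1 + 3 = i + 3 + 1 by ring, pow_succ]
      calc _ = (2 * (i + 5)) * (2 ^ (i + 3) * (i + 4).factorial) := by ring
        _ < (2 * (i + 5)) * (2 * (i + 3)).factorial := by gcongr
        _ ≤ ((2 * (i + 3) + 2) * (2 * (i + 3) + 1)) * (2 * (i + 3)).factorial := by
          apply Nat.mul_le_mul_right
          nlinarith
        _ = _ := by ring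
  rcases j with _ | _ | _ | i
  · rfl
  · exfalso
    obtain ⟨m, rfl⟩ : ∃ m, n = m + 4 := ⟨n - 4, by omega⟩
    rw [show m + 4 - 2 = m + 2 by omega, Nat.choose_two_right] at h2
    have : (m + 2) * (m + 1) / 2 = 2 := by simp [Nat.factorial] at h2; omega
    rcases m with _ | m
    · simp at this
    · have : 3 ≤ (m + 1 + 2) * (m + 1 + 1) / 2 := by
        rw [Nat.le_div_iff_mul_le (by norm_num)]; nlinarith
      omega
  · exfalso
    -- Here `2 ^ 2 * 3! = 4!`, so the equation does hold for `n = 6`, the excluded case.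
    have : (n - 2).choose 4 = 1 := by simp [Nat.factorial] at h2; omega
    have h5 : 5 ≤ (n - 2).choose 4 := by
      calc 5 = Nat.choose 5 4 := by decide
        _ ≤ _ := Nat.choose_le_choose 4 (by omega)
    omega
  · exfalso
    have := hbig i
    rw [show i + 1 + 1 + 1 = i + 3 by ring] at h2
    nlinarith

variable {α : Type*} [DecidableEq α]

/-- The image has order 2, so it is a product of disjoint transpositions; its centralizer has the
same order as that of `σ`, which leaves only one transposition. -/
theorem isSwap_mulEquiv_apply [Fintype α] (hα : Fintype.card α ≠ 6) (φ : Perm α ≃* Perm α) {σ : Perm α}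
    (hσ : σ.IsSwap) : (φ σ).IsSwap := by
  have ho : orderOf (φ σ) = 2 := by rw [MulEquiv.orderOf_eq, hσ.orderOf]
  obtain ⟨k, hk⟩ := cycleType_prime_order (σ := φ σ) (by rw [ho]; exact Nat.prime_two)
  have hcard : Nat.card (Subgroup.centralizer {φ σ}) = Nat.card (Subgroup.centralizer {σ}) := by
    refine (Nat.card_congr (φ.toEquiv.subtypeEquiv fun x => ?_)).symm
    simp only [Subgroup.mem_centralizer_singleton_iff, MulEquiv.toEquiv_eq_coe,
      EquivLike.coe_coe, ← map_mul, φ.injective.eq_iff]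
  have hle := sum_cycleType_le (φ σ)
  rw [nat_card_centralizer, nat_card_centralizer, isSwap_iff_cycleType.mp hσ, hk, ho] at hcard
  rw [hk, ho] at hle
  rw [isSwap_iff_cycleType, hk, ho]
  simp only [Multiset.sum_replicate, Multiset.prod_replicate, smul_eq_mul,
    Multiset.toFinset_replicate, Nat.succ_ne_zero, if_false, Finset.prod_singleton,
    Multiset.count_replicate_self, Multiset.sum_singleton, Multiset.prod_singleton,
    Multiset.toFinset_singleton, Multiset.count_singleton_self, Nat.factorial_one, mul_one]
    at hcard hle
  rw [mul_comm (k + 1) 2] at hcard hle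
  have := eq_one_of_two_pow_mul_factorial_eq hα (by omega) hle hcard
  rw [this]
  rfl

theorem swap_self_eq_one (a : α) : swap a a = (1 : Perm α) := swap_self a

theorem exists_eq_of_swap_mul_swap_ne {a b c d : α}
    (h : swap a b * swap c d ≠ swap c d * swap a b) : a = c ∨ a = d ∨ b = c ∨ b = d := by
  by_contra! hne
  rcases eq_or_ne a b with rfl | hab
  · exact h (by rw [swap_self_eq_one, one_mul, mul_one])
  rcases eq_or_ne c d with rfl | hcd
  · exact h (by rw [swap_self_eq_one, one_mul, mul_one])
  exact h (disjoint_swap_swap (by simp [hne, hab, hcd])).commute.eq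

/-- Two swaps that do not commute have exactly one point in common. -/
theorem exists_common_of_isSwap {σ τ : Perm α} (hσ : σ.IsSwap) (hτ : τ.IsSwap)
    (h : σ * τ ≠ τ * σ) : ∃ p q s, p ≠ q ∧ p ≠ s ∧ q ≠ s ∧ σ = swap p q ∧ τ = swap p s := by
  obtain ⟨a, b, hab, rfl⟩ := hσ
  obtain ⟨c, d, hcd, rfl⟩ := hτ
  rcases exists_eq_of_swap_mul_swap_ne h with rfl | rfl | rfl | rfl
  · refine ⟨a, b, d, hab, hcd, ?_, rfl, rfl⟩
    rintro rfl
    exact h rfl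
  · refine ⟨a, b, c, hab, hcd.symm, ?_, rfl, swap_comm _ _⟩
    rintro rfl
    exact h (by rw [swap_comm])
  · refine ⟨b, a, d, hab.symm, hcd, ?_, swap_comm _ _, rfl⟩
    rintro rfl
    exact h (by rw [swap_comm])
  · refine ⟨b, a, c, hab.symm, hcd.symm, ?_, swap_comm _ _, swap_comm _ _⟩
    rintro rfl
    exact h rfl

theorem swap_mul_swap_ne {o i j : α} (hi : i ≠ o) (hj : j ≠ o) (hij : i ≠ j) :
    swap o i * swap o j ≠ swap o j * swap o i := fun h => by
  have := congrArg (fun f : Perm α => f o) h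
  simp only [mul_apply, swap_apply_left, swap_apply_of_ne_of_ne hj hij.symm,
    swap_apply_of_ne_of_ne hi hij] at this
  exact hij this.symm

/-- The map `k ↦ q`, normalized to send `o` to `p`, is injective, hence a permutation. Conjugation
by it agrees with `φ` on the swaps through `o`, and these generate. -/
theorem exists_eq_conj_of_star [Fintype α] (φ : Perm α ≃* Perm α) (o p : α)
    (h : ∀ k, ∃ q, φ (swap o k) = swap p q) : ∃ g, ∀ x, φ x = g * x * g⁻¹ := by
  have h' : ∀ k, ∃ q, φ (swap o k) = swap p q ∧ (k = o → q = p) := fun k => by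
    rcases eq_or_ne k o with rfl | hk
    · exact ⟨p, by rw [swap_self_eq_one, swap_self_eq_one, map_one], fun _ => rfl⟩
    · obtain ⟨q, hq⟩ := h k
      exact ⟨q, hq, fun e => absurd e hk⟩
  choose g hg hgo using h'
  have hinj : Function.Injective g := fun k l e => by
    have := φ.injective ((hg k).trans ((congrArg (swap p) e).trans (hg l).symm))
    simpa using congrArg (fun f : Perm α => f o) this
  let e : Perm α := Equiv.ofBijective g (Finite.injective_iff_bijective.mp hinj)
  have he : ∀ k, φ (swap o k) = e * swap o k * e⁻¹ := fun k => by
    rw [hg, ← swap_apply_apply]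
    change _ = swap (g o) (g k)
    rw [hgo o rfl]
  refine ⟨e, fun x => ?_⟩
  have := MonoidHom.eq_of_eqOn_dense (f := φ.toMonoidHom) (g := (MulAut.conj e).toMonoidHom)
    (closure_isSwap (α := α)) ?_
  · exact DFunLike.congr_fun this x
  · rintro _ ⟨i, j, hij, rfl⟩
    change φ (swap i j) = MulAut.conj e (swap i j)
    have he' : ∀ k, φ (swap o k) = MulAut.conj e (swap o k) := he
    rcases eq_or_ne i o with rfl | hi
    · exact he' j
    rcases eq_or_ne j o with rfl | hj
    · rw [swap_comm]
      exact he' i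
    · have : swap i j = swap o i * swap o j * (swap o i)⁻¹ := by
        rw [← swap_apply_apply, swap_apply_left, swap_apply_of_ne_of_ne hj hij.symm]
      rw [this, map_mul, map_mul, map_mul, map_mul, map_inv, map_inv, he', he']

/-- Non-commuting transpositions share exactly one point. Let `p` be the point common to the images
of `(o i)` and `(o j)`; the image of every other `(o k)` must also pass through `p`, so the star at
`o` goes to the star at `p`. -/
theorem exists_eq_conj [Fintype α] (hα : Fintype.card α ≠ 6) (φ : Perm α ≃* Perm α) :
    ∃ g, ∀ x, φ x = g * x * g⁻¹ := by
  rcases le_or_gt (Fintype.card α) 2 with hle | hgt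
  · refine ⟨1, fun x => ?_⟩
    have hc : Fintype.card (Perm α) ≤ 2 := by
      rw [Fintype.card_perm]
      exact Nat.factorial_le hle
    rw [one_mul, inv_one, mul_one]
    rcases eq_or_ne x 1 with rfl | hx
    · exact map_one φ
    by_contra hne
    have : 2 < Fintype.card (Perm α) := Fintype.two_lt_card_iff.mpr
      ⟨φ x, x, 1, hne, fun e => hx (by simpa using e), hx⟩
    omega
  obtain ⟨o, i, j, hoi, hoj, hij⟩ := Fintype.two_lt_card_iff.mp hgt
  have hsw : ∀ k l, k ≠ l → (φ (swap k l)).IsSwap := fun k l hkl =>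
    isSwap_mulEquiv_apply hα φ ⟨k, l, hkl, rfl⟩
  have hnc : ∀ k l, k ≠ o → l ≠ o → k ≠ l →
      φ (swap o k) * φ (swap o l) ≠ φ (swap o l) * φ (swap o k) := fun k l hk hl hkl e => by
    rw [← map_mul, ← map_mul, φ.injective.eq_iff] at e
    exact swap_mul_swap_ne hk hl hkl e
  obtain ⟨p, q, s, hpq, hps, hqs, hi, hj⟩ := exists_common_of_isSwap (hsw o i hoi) (hsw o j hoj)
    (hnc i j hoi.symm hoj.symm hij)
  refine exists_eq_conj_of_star φ o p fun k => ?_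
  rcases eq_or_ne k o with rfl | hko
  · exact ⟨p, by rw [swap_self_eq_one, swap_self_eq_one, map_one]⟩
  rcases eq_or_ne k i with rfl | hki
  · exact ⟨q, hi⟩
  rcases eq_or_ne k j with rfl | hkj
  · exact ⟨s, hj⟩
  have hij' : φ (swap i j) = swap q s := by
    have e1 : swap i j = swap o i * swap o j * (swap o i)⁻¹ := by
      rw [← swap_apply_apply, swap_apply_left, swap_apply_of_ne_of_ne hoj.symm hij.symm]
    rw [e1, map_mul, map_mul, map_inv, hi, hj, ← swap_apply_apply, swap_apply_left,
      swap_apply_of_ne_of_ne hps.symm hqs.symm]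
  obtain ⟨x, y, hxy, hk⟩ := hsw o k hko.symm
  have h1 := hnc i k hoi.symm hko hki.symm
  have h2 := hnc j k hoj.symm hko hkj.symm
  rw [hi, hk] at h1
  rw [hj, hk] at h2
  have h1' := exists_eq_of_swap_mul_swap_ne h1
  have h2' := exists_eq_of_swap_mul_swap_ne h2
  by_cases hx : p = x
  · exact ⟨y, by rw [hk, hx]⟩
  by_cases hy : p = y
  · exact ⟨x, by rw [hk, hy, swap_comm]⟩
  exfalso
  -- A transposition that meets `{p, q}` and `{p, s}` but avoids `p` is `(q s)`, already the image
  -- of `(i j)`.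
  have hqs' : swap q s = swap x y := by
    rcases h1' with h | h | h | h <;> rcases h2' with h' | h' | h' | h' <;>
      first
      | exact absurd h hx
      | exact absurd h hy
      | exact absurd h' hx
      | exact absurd h' hy
      | exact absurd (h.trans h'.symm) hqs
      | (rw [h, h']; done)
      | exact (swap_comm _ _).trans (by rw [h, h'])
  have := φ.injective (hk.trans (hqs'.symm.trans hij'.symm))
  have := congrArg (fun f : Perm α => f o) this
  simp only [swap_apply_left, swap_apply_of_ne_of_ne hoi hoj] at this
  exact hko this

end Equiv.Perm

/-! ### Wreath products as centralizers, and their characters -/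

/-- The group `κ → C` of functions into the cyclic group `C` of order `m`, extended by the
permutations of `κ`. -/
abbrev CyclicWreath (κ : Type*) (m : ℕ) : Type _ :=
  (κ → Multiplicative (ZMod m)) ⋊[mulAutArrow (G := Equiv.Perm κ)] Equiv.Perm κ

/-- The permutation `(c, a) ↦ (c, a + 1)`. -/
def cyclicShift (κ : Type*) (m : ℕ) : Equiv.Perm (κ × ZMod m) :=
  Equiv.prodCongr (Equiv.refl κ) (Equiv.addRight 1)

theorem cyclicShift_apply {κ : Type*} {m : ℕ} (x : κ × ZMod m) :
    cyclicShift κ m x = (x.1, x.2 + 1) := rfl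

theorem cyclicShift_pow_apply {κ : Type*} {m : ℕ} (k : ℕ) (x : κ × ZMod m) :
    (cyclicShift κ m ^ k) x = (x.1, x.2 + k) := by
  induction k with
  | zero => simp
  | succ k ih =>
    rw [pow_succ', Equiv.Perm.mul_apply, ih, cyclicShift_apply]
    simp [add_assoc]

namespace CyclicWreath

variable {κ : Type*} {m : ℕ}

theorem mulAutArrow_perm_apply {M : Type*} [Monoid M] (π : Equiv.Perm κ) (f : κ → M) (c : κ) :
    (mulAutArrow π f : κ → M) c = f (π⁻¹ c) := rfl

/-- The action of the wreath product on `κ × ZMod m`. -/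
def toPerm : CyclicWreath κ m →* Equiv.Perm (κ × ZMod m) where
  toFun x :=
    { toFun := fun y => (x.right y.1, (x.left (x.right y.1)).toAdd + y.2)
      invFun := fun y => (x.right⁻¹ y.1, -(x.left y.1).toAdd + y.2)
      left_inv := fun y => by simp
      right_inv := fun y => by simp }
  map_one' := by
    ext y <;> simp
  map_mul' x x' := by
    refine Equiv.ext fun y => Prod.ext rfl ?_
    change ((x * x').left ((x.right * x'.right) y.1)).toAdd + y.2 =
      (x.left (x.right (x'.right y.1))).toAdd + ((x'.left (x'.right y.1)).toAdd + y.2)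
    rw [SemidirectProduct.mul_left, Pi.mul_apply, mulAutArrow_perm_apply]
    simp [add_assoc]

theorem toPerm_apply (x : CyclicWreath κ m) (y : κ × ZMod m) :
    toPerm x y = (x.right y.1, (x.left (x.right y.1)).toAdd + y.2) := rfl

theorem toPerm_injective : Function.Injective (toPerm (κ := κ) (m := m)) := by
  intro x x' h
  have h1 : ∀ c, (x.right c, (x.left (x.right c)).toAdd + 0) =
      (x'.right c, (x'.left (x'.right c)).toAdd + 0) := fun c =>
    congrArg (fun f : Equiv.Perm (κ × ZMod m) => f (c, 0)) h
  have hr : x.right = x'.right := Equiv.ext fun c => (Prod.ext_iff.mp (h1 c)).1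
  refine SemidirectProduct.ext (funext fun c => ?_) hr
  have := (Prod.ext_iff.mp (h1 (x.right⁻¹ c))).2
  rw [← hr] at this
  simpa using this

theorem toPerm_mem_centralizer (x : CyclicWreath κ m) :
    toPerm x ∈ Subgroup.centralizer {cyclicShift κ m} := by
  rw [Subgroup.mem_centralizer_singleton_iff]
  refine Equiv.ext fun y => ?_
  simp [toPerm_apply, cyclicShift_apply, add_assoc]

/-- Commuting with the shift, `z` is determined by its values at the points `(c, 0)`: their first
coordinates permute `κ`, their second ones are the rotations. -/
theorem exists_toPerm_eq [Finite κ] [NeZero m] {z : Equiv.Perm (κ × ZMod m)}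
    (hz : z ∈ Subgroup.centralizer {cyclicShift κ m}) :
    ∃ x : CyclicWreath κ m, toPerm x = z := by
  rw [Subgroup.mem_centralizer_singleton_iff] at hz
  have hz' : ∀ (k : ℕ) y, z (y.1, y.2 + k) = ((z y).1, (z y).2 + k) := fun k y => by
    have h : Commute z (cyclicShift κ m ^ k) := Commute.pow_right hz k
    rw [← cyclicShift_pow_apply, ← cyclicShift_pow_apply, ← Equiv.Perm.mul_apply, h.eq,
      Equiv.Perm.mul_apply]
  have key : ∀ c a, z (c, a) = ((z (c, 0)).1, (z (c, 0)).2 + a) := fun c a => by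
    have := hz' a.val (c, 0)
    simpa using this
  have hinj : Function.Injective fun c => (z (c, 0)).1 := fun c d h => by
    have : z (c, (z (d, 0)).2 - (z (c, 0)).2) = z (d, 0) := by
      rw [key]
      exact Prod.ext h (by simp)
    exact (Prod.ext_iff.mp (z.injective this)).1
  let π : Equiv.Perm κ := Equiv.ofBijective _ (Finite.injective_iff_bijective.mp hinj)
  -- `toPerm` reads the rotation at the target cycle, hence `π⁻¹`.
  refine ⟨⟨fun c => Multiplicative.ofAdd (z (π⁻¹ c, 0)).2, π⟩, Equiv.ext fun y => ?_⟩
  rw [toPerm_apply]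
  obtain ⟨c, a⟩ := y
  rw [key]
  refine Prod.ext rfl ?_
  simp

/-- The wreath product is the centralizer of a product of disjoint cycles of length `m`. -/
noncomputable def mulEquivCentralizer [Finite κ] [NeZero m] :
    CyclicWreath κ m ≃* Subgroup.centralizer {cyclicShift κ m} :=
  MulEquiv.ofBijective (toPerm.codRestrict _ toPerm_mem_centralizer)
    ⟨fun _ _ h => toPerm_injective (congrArg Subtype.val h), fun z => by
      obtain ⟨x, hx⟩ := exists_toPerm_eq z.2
      exact ⟨x, Subtype.ext hx⟩⟩

/-- A homomorphism from the wreath product to a commutative group is determined by its restrictions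
to one copy of the cyclic group and to the group of permutations, which are arbitrary. -/
theorem card_monoidHom_eq_mul [Finite κ] [Nonempty κ] (A : Type*) [CommGroup A] :
    Nat.card (CyclicWreath κ m →* A) =
      Nat.card (Multiplicative (ZMod m) →* A) * Nat.card (Equiv.Perm κ →* A) := by
  classical
  have := Fintype.ofFinite κ
  obtain ⟨c₀⟩ := ‹Nonempty κ›
  rw [← Nat.card_prod]
  refine Nat.card_eq_of_bijective (fun χ : CyclicWreath κ m →* A =>
    ((χ.comp SemidirectProduct.inl).comp (MonoidHom.mulSingle (fun _ : κ => Multiplicative (ZMod m)) c₀),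
      χ.comp SemidirectProduct.inr)) ⟨?_, ?_⟩
  · intro χ χ' h
    rw [Prod.ext_iff] at h
    refine SemidirectProduct.hom_ext (MonoidHom.functions_ext _ _ _ fun c x => ?_) h.2
    -- All copies of the cyclic group are conjugate under the permutations, so the copy at `c₀`
    -- determines the others.
    have hs : Pi.mulSingle c x = mulAutArrow (Equiv.swap c c₀)
        (Pi.mulSingle c₀ x : κ → Multiplicative (ZMod m)) := by
      funext d
      rw [mulAutArrow_perm_apply, Equiv.swap_inv]
      rcases eq_or_ne d c with rfl | hd
      · simp
      · rw [Pi.mulSingle_eq_of_ne hd, Pi.mulSingle_eq_of_ne]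
        rwa [Ne, Equiv.swap_apply_eq_iff, Equiv.swap_apply_right]
    have h1 := DFunLike.congr_fun h.1 x
    simp only [MonoidHom.comp_apply, MonoidHom.mulSingle_apply] at h1 ⊢
    rw [hs, SemidirectProduct.inl_aut]
    simp only [map_mul, map_inv, mul_inv_cancel_comm, h1]
  · rintro ⟨ψ, θ⟩
    -- The product of `ψ` over all coordinates is invariant under permuting them, so it extends by
    -- `θ`.
    refine ⟨SemidirectProduct.lift (∏ c, ψ.comp (Pi.evalMonoidHom _ c)) θ ?_, ?_⟩
    · intro π
      refine MonoidHom.ext fun x => ?_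
      simp only [MonoidHom.comp_apply, MonoidHom.finsetProd_apply, MulEquiv.coe_toMonoidHom,
        Pi.evalMonoidHom_apply, mulAutArrow_perm_apply, MulAut.conj_apply, mul_inv_cancel_comm]
      exact Equiv.prod_comp π⁻¹ fun c => ψ (x c)
    · refine Prod.ext (MonoidHom.ext fun x => ?_) (SemidirectProduct.lift_comp_inr _ _ _)
      simp [MonoidHom.finsetProd_apply, ← map_prod]

end CyclicWreath

theorem card_zmod_monoidHom_units {F : Type*} [Field F] {m : ℕ} [NeZero m] {ζ : F}
    (hζ : IsPrimitiveRoot ζ m) : Nat.card (Multiplicative (ZMod m) →* Fˣ) = m := by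
  have : HasEnoughRootsOfUnity F (Monoid.exponent (Multiplicative (ZMod m))) := by
    rw [show Monoid.exponent (Multiplicative (ZMod m)) = m by simp]
    exact ⟨⟨ζ, hζ⟩, inferInstance⟩
  rw [CommGroup.card_monoidHom_of_hasEnoughRootsOfUnity]
  simp

/-- Swaps are conjugate and generate, so a character is given by its common value on them, a square
root of 1. The value `-1` is attained by the sign. -/
theorem card_perm_monoidHom_units {F : Type*} [Field F] (hF : (-1 : F) ≠ 1) (κ : Type*) [Finite κ]
    [Nontrivial κ] : Nat.card (Equiv.Perm κ →* Fˣ) = 2 := by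
  classical
  have := Fintype.ofFinite κ
  obtain ⟨a, b, hab⟩ := exists_pair_ne κ
  let θ₀ : Equiv.Perm κ →* Fˣ := (Units.map (Int.castRingHom F).toMonoidHom).comp Equiv.Perm.sign
  have hθ₀ : ∀ c d, c ≠ d → θ₀ (Equiv.swap c d) = -1 := fun c d hcd => by
    refine Units.ext ?_
    simp [θ₀, Equiv.Perm.sign_swap hcd]
  have hne : (-1 : Fˣ) ≠ 1 := fun h => hF (by simpa using congrArg Units.val h)
  have huniv : (Set.univ : Set (Equiv.Perm κ →* Fˣ)) = {1, θ₀} := by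
    symm
    rw [Set.eq_univ_iff_forall]
    intro θ
    have hsw : ∀ c d, c ≠ d → θ (Equiv.swap c d) = θ (Equiv.swap a b) := fun c d hcd =>
      isConj_iff_eq.mp (θ.map_isConj (Equiv.Perm.isConj_swap hcd hab))
    have hsq : θ (Equiv.swap a b) = 1 ∨ θ (Equiv.swap a b) = -1 := by
      have : θ (Equiv.swap a b) * θ (Equiv.swap a b) = 1 := by
        rw [← map_mul, Equiv.swap_mul_self, map_one]
      have := congrArg Units.val this
      rcases mul_self_eq_one_iff.mp this with h | h
      · exact Or.inl (Units.ext h)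
      · exact Or.inr (Units.ext h)
    rcases hsq with h | h
    · refine Or.inl (MonoidHom.eq_of_eqOn_dense Equiv.Perm.closure_isSwap ?_)
      rintro _ ⟨c, d, hcd, rfl⟩
      rw [hsw c d hcd, h]
      rfl
    · refine Or.inr (MonoidHom.eq_of_eqOn_dense Equiv.Perm.closure_isSwap ?_)
      rintro _ ⟨c, d, hcd, rfl⟩
      rw [hsw c d hcd, h, hθ₀ c d hcd]
  rw [← Set.ncard_univ, huniv, Set.ncard_pair]
  intro h
  apply hne
  rw [← hθ₀ a b hab, ← h]
  rfl

/-- At most one of the two factors differs from 1 by its condition. For empty `κ` the group is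
trivial, so no root of unity is required for cycle lengths that do not occur. -/
theorem card_monoidHom_centralizer_cyclicShift {F : Type*} [Field F] (κ : Type*) [Finite κ] (m : ℕ)
    [NeZero m] (hroot : 1 ≤ Nat.card κ → ∃ ζ : F, IsPrimitiveRoot ζ m)
    (hneg : 2 ≤ Nat.card κ → (-1 : F) ≠ 1) :
    Nat.card (Subgroup.centralizer {cyclicShift κ m} →* Fˣ) =
      (if Nat.card κ = 1 then m else 1) * if 2 ≤ Nat.card κ then 2 * m else 1 := by
  rw [← Nat.card_congr
    (MulEquiv.monoidHomCongrLeftEquiv (CyclicWreath.mulEquivCentralizer (κ := κ) (m := m)))]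
  rcases isEmpty_or_nonempty κ with hκ | hκ
  · have : Subsingleton (CyclicWreath κ m) :=
      ⟨fun x y => SemidirectProduct.ext (Subsingleton.elim _ _) (Subsingleton.elim _ _)⟩
    have : Subsingleton (CyclicWreath κ m →* Fˣ) :=
      ⟨fun f g => MonoidHom.ext fun x => by rw [Subsingleton.elim x 1, map_one, map_one]⟩
    simp [Nat.card_unique]
  have hpos : 1 ≤ Nat.card κ := Nat.card_pos
  obtain ⟨ζ, hζ⟩ := hroot hpos
  rw [CyclicWreath.card_monoidHom_eq_mul, card_zmod_monoidHom_units hζ]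
  rcases eq_or_lt_of_le hpos with h1 | h2
  · have : Subsingleton κ := (Nat.card_eq_one_iff_unique.mp h1.symm).1
    have : Subsingleton (Equiv.Perm κ →* Fˣ) :=
      ⟨fun f g => MonoidHom.ext fun x => by rw [Subsingleton.elim x 1, map_one, map_one]⟩
    simp [Nat.card_unique]
  · have : Nontrivial κ := Finite.one_lt_card_iff_nontrivial.mp h2
    rw [card_perm_monoidHom_units (hneg h2), if_neg (by omega), if_pos (by omega)]
    ring

/-! ### Normal form of a permutation by its cycles -/

open Function in
theorem Equiv.Perm.card_support_cycleOf_eq_minimalPeriod {α : Type*} [Fintype α] [DecidableEq α]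
    {σ : Equiv.Perm α} {x : α} (hx : σ x ≠ x) : (σ.cycleOf x).support.card = minimalPeriod σ x := by
  have hc := σ.isCycle_cycleOf hx
  rw [← hc.orderOf]
  refine Nat.dvd_right_iff_eq.mp fun k => ?_
  rw [orderOf_dvd_iff_pow_eq_one, ← isPeriodicPt_iff_minimalPeriod_dvd,
    hc.pow_eq_one_iff' (x := x) (by rwa [Equiv.Perm.cycleOf_apply_self]),
    Equiv.Perm.cycleOf_pow_apply_self, IsPeriodicPt, IsFixedPt, Equiv.Perm.iterate_eq_pow]

/-- The points of period `i` lie on the cycles of length `i`. -/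
theorem Equiv.Perm.card_minimalPeriod_eq {α : Type*} [Fintype α] [DecidableEq α]
    (σ : Equiv.Perm α) {i : ℕ} (hi : 1 ≤ i) :
    Nat.card {x // Function.minimalPeriod σ x = i} = i * σ.partition.parts.count i := by
  rw [Nat.card_eq_fintype_card, Fintype.card_subtype, parts_partition, Multiset.count_add,
    Multiset.count_replicate]
  -- `cycleType` omits fixed points; in `partition` they are added as parts equal to 1.
  rcases hi.eq_or_lt with rfl | hi
  · have h0 : σ.cycleType.count 1 = 0 :=
      Multiset.count_eq_zero.mpr fun h => absurd (two_le_of_mem_cycleType h) (by norm_num)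
    rw [h0, if_pos rfl, zero_add, one_mul, ← Finset.card_compl]
    congr 1
    ext x
    simp [Function.minimalPeriod_eq_one_iff_isFixedPt, Function.IsFixedPt]
  · have hset : Finset.univ.filter (fun x => Function.minimalPeriod σ x = i) =
        (σ.cycleFactorsFinset.filter fun c => c.support.card = i).biUnion support := by
      ext x
      simp only [Finset.mem_filter, Finset.mem_univ, true_and, Finset.mem_biUnion]
      constructor
      · intro h
        have hx : σ x ≠ x := fun hx => by
          rw [Function.minimalPeriod_eq_one_iff_isFixedPt.mpr hx] at h
          omega
        refine ⟨σ.cycleOf x, ⟨?_, ?_⟩, ?_⟩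
        · rwa [cycleOf_mem_cycleFactorsFinset_iff, mem_support]
        · rw [card_support_cycleOf_eq_minimalPeriod hx, h]
        · rwa [mem_support, cycleOf_apply_self]
      · rintro ⟨c, ⟨hc, hci⟩, hx⟩
        have hx' : σ x ≠ x :=
          mem_support.mp (mem_cycleFactorsFinset_support_le hc hx)
        rw [← card_support_cycleOf_eq_minimalPeriod hx', ← cycle_is_cycleOf hx hc, hci]
    rw [hset, Finset.card_biUnion, Finset.sum_congr rfl
      (fun c hc => (Finset.mem_filter.mp hc).2), Finset.sum_const, smul_eq_mul, mul_comm,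
      if_neg (by omega), add_zero, cycleType_def, Multiset.count_map, Finset.card_def,
      Finset.filter_val]
    · simp only [Function.comp_apply, eq_comm]
    · intro c hc d hd hcd
      exact (σ.cycleFactorsFinset_pairwise_disjoint (Finset.mem_filter.mp hc).1
        (Finset.mem_filter.mp hd).1 hcd).disjoint_support

/-- A sum of permutations `(c, a) ↦ (c, a + 1)` of `κ i × ZMod i`. -/
def sigmaShift {I : Finset ℕ} (κ : I → Type*) : Equiv.Perm (Σ i : I, κ i × ZMod i) :=
  Equiv.Perm.sigmaCongrRight fun i => cyclicShift (κ i) i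

theorem sigmaShift_pow_apply {I : Finset ℕ} {κ : I → Type*} (k : ℕ) (x : Σ i : I, κ i × ZMod i) :
    (sigmaShift κ ^ k) x = ⟨x.1, x.2.1, x.2.2 + k⟩ := by
  induction k with
  | zero => simp
  | succ k ih =>
    rw [pow_succ', Equiv.Perm.mul_apply, ih, Nat.cast_succ, ← add_assoc]
    rfl

theorem sigmaShift_pow_apply_eq_iff {I : Finset ℕ} {κ : I → Type*} (k : ℕ)
    (x : Σ i : I, κ i × ZMod i) : (sigmaShift κ ^ k) x = x ↔ (x.1 : ℕ) ∣ k := by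
  obtain ⟨i, c, a⟩ := x
  rw [sigmaShift_pow_apply, ← ZMod.natCast_eq_zero_iff]
  simp

-- Once an orbit is identified with `ZMod` of its length, the generator acts as `a ↦ a + 1`.
open MulAction Function in
theorem orbitZPowersEquiv_symm_add_one {G α : Type*} [Group G] [MulAction G α] (g : G) (x : α)
    (a : ZMod (minimalPeriod (g • ·) x)) :
    ((orbitZPowersEquiv g x).symm (a + 1) : α) = g • ((orbitZPowersEquiv g x).symm a : α) := by
  obtain ⟨k, rfl⟩ := ZMod.intCast_surjective a
  have h : ((k : ZMod (minimalPeriod (g • ·) x)) + 1) = ((k + 1 : ℤ) : ZMod _) := by push_cast; rfl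
  rw [h, orbitZPowersEquiv_symm_apply', orbitZPowersEquiv_symm_apply', add_comm, zpow_add, zpow_one,
    mul_smul]
  rfl

open MulAction Function in
/-- The length of the cycle with index `ω`. -/
noncomputable def cycleLength {α : Type*} (σ : Equiv.Perm α)
    (ω : orbitRel.Quotient (Subgroup.zpowers σ) α) : ℕ :=
  minimalPeriod (σ • · : α → α) ω.out

open MulAction Function in
/-- Every permutation is conjugate to a sum of permutations `(c, a) ↦ (c, a + 1)`. -/
theorem exists_equiv_sigmaShift.{u} {α : Type u} [Fintype α] (σ : Equiv.Perm α) :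
    ∃ (κ : Finset.Icc 1 (Fintype.card α) → Type u) (e : α ≃ Σ i : Finset.Icc 1 (Fintype.card α),
      κ i × ZMod i), ∀ y, e.symm (sigmaShift κ y) = σ (e.symm y) := by
  have hmem : ∀ ω, cycleLength σ ω ∈ Finset.Icc 1 (Fintype.card α) := fun ω =>
    Finset.mem_Icc.mpr ⟨minimalPeriod_pos_of_mem_periodicPts
      (σ.injective.mem_periodicPts _), minimalPeriod_le_card⟩
  -- `κ i` is the set of cycles of length `i`.
  let κ : Finset.Icc 1 (Fintype.card α) → Type _ := fun i => {ω // cycleLength σ ω = i}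
  let T : (Σ ω, ZMod (cycleLength σ ω)) ≃ Σ i : Finset.Icc 1 (Fintype.card α), κ i × ZMod i :=
    { toFun := fun y => ⟨⟨cycleLength σ y.1, hmem _⟩, ⟨y.1, rfl⟩, y.2⟩
      invFun := fun y => ⟨y.2.1.1, cast (by rw [y.2.1.2]) y.2.2⟩
      left_inv := fun y => rfl
      right_inv := by
        rintro ⟨⟨i, hi⟩, ⟨ω, hω⟩, a⟩
        change cycleLength σ ω = i at hω
        subst hω
        rfl }
  refine ⟨κ, ((selfEquivSigmaOrbits (Subgroup.zpowers σ) α).trans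
    (Equiv.sigmaCongrRight fun ω => orbitZPowersEquiv σ ω.out)).trans T, ?_⟩
  rintro ⟨⟨i, hi⟩, ⟨ω, hω⟩, a⟩
  change cycleLength σ ω = i at hω
  subst hω
  exact orbitZPowersEquiv_symm_add_one σ ω.out a

/-- Count the points of period `i` twice: they form `κ i × ZMod i`, and they fill the cycles of
length `i`. -/
theorem card_eq_count_of_equiv_sigmaShift {α : Type*} [Fintype α] [DecidableEq α]
    {σ : Equiv.Perm α} {I : Finset ℕ} {κ : I → Type*} (hI : ∀ i ∈ I, 1 ≤ i)
    (e : α ≃ Σ i : I, κ i × ZMod i) (he : ∀ y, e.symm (sigmaShift κ y) = σ (e.symm y)) (i : I) :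
    Nat.card (κ i) = σ.partition.parts.count (i : ℕ) := by
  have hi := hI i i.2
  have hpow : ∀ (k : ℕ) y, e.symm ((sigmaShift κ ^ k) y) = (σ ^ k) (e.symm y) := fun k y => by
    induction k with
    | zero => rfl
    | succ k ih => rw [pow_succ', pow_succ', Equiv.Perm.mul_apply, Equiv.Perm.mul_apply, he, ih]
  have hper : ∀ y, Function.minimalPeriod σ (e.symm y) = y.1 := fun y => by
    refine Nat.dvd_right_iff_eq.mp fun k => ?_
    rw [← Function.isPeriodicPt_iff_minimalPeriod_dvd, Function.IsPeriodicPt, Function.IsFixedPt,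
      Equiv.Perm.iterate_eq_pow, ← hpow, e.symm.injective.eq_iff, sigmaShift_pow_apply_eq_iff]
  have hcard : Nat.card {x // Function.minimalPeriod σ x = i} = Nat.card (κ i × ZMod i) := by
    refine (Nat.card_congr (Equiv.ofBijective
      (fun y => ⟨e.symm ⟨i, y⟩, hper _⟩ : κ i × ZMod i → {x // Function.minimalPeriod σ x = i})
      ⟨fun y y' h => ?_, ?_⟩)).symm
    · have := e.symm.injective (congrArg Subtype.val h)
      simpa using this
    · rintro ⟨x, hx⟩
      obtain ⟨⟨j, y⟩, rfl⟩ := e.symm.surjective x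
      rw [hper] at hx
      obtain rfl : j = i := Subtype.ext hx
      exact ⟨y, rfl⟩
  rw [σ.card_minimalPeriod_eq hi, Nat.card_prod, Nat.card_zmod, mul_comm] at hcard
  exact (Nat.eq_of_mul_eq_mul_right hi hcard).symm

/-! ### Characters of the centralizer of an arbitrary permutation -/

/-- The homomorphisms from a finite product of groups to a commutative group. -/
noncomputable def piMonoidHomEquiv {ι : Type*} [Fintype ι] [DecidableEq ι] (M : ι → Type*)
    [∀ i, Monoid (M i)] (A : Type*) [CommMonoid A] : ((∀ i, M i) →* A) ≃ ∀ i, M i →* A where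
  toFun f i := f.comp (MonoidHom.mulSingle M i)
  invFun g := ∏ i, (g i).comp (Pi.evalMonoidHom M i)
  left_inv f := by
    refine MonoidHom.pi_ext fun i x => ?_
    rw [MonoidHom.finsetProd_apply, Finset.prod_eq_single i]
    · simp
    · intro j _ hj
      simp [Pi.mulSingle_eq_of_ne hj]
    · simp
  right_inv g := by
    refine funext fun i => MonoidHom.ext fun x => ?_
    rw [MonoidHom.comp_apply, MonoidHom.finsetProd_apply, Finset.prod_eq_single i]
    · simp
    · intro j _ hj
      simp [Pi.mulSingle_eq_of_ne hj]
    · simp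

/-- A permutation of a disjoint union that preserves the summands is a sum of permutations. -/
theorem Equiv.Perm.exists_sigmaCongrRight_eq {I : Type*} {β : I → Type*} [∀ i, Finite (β i)]
    (z : Equiv.Perm (Σ i, β i)) (hz : ∀ y, (z y).1 = y.1) :
    ∃ g : ∀ i, Equiv.Perm (β i), Equiv.Perm.sigmaCongrRight g = z := by
  have h : ∀ i b, ∃ b', z ⟨i, b⟩ = ⟨i, b'⟩ := fun i b => by
    have := hz ⟨i, b⟩
    generalize z ⟨i, b⟩ = w at this
    obtain ⟨j, b'⟩ := w
    obtain rfl : j = i := this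
    exact ⟨b', rfl⟩
  choose g hg using h
  have hinj : ∀ i, Function.Injective (g i) := fun i b b' e => by
    have := z.injective ((hg i b).trans ((congrArg (Sigma.mk i) e).trans (hg i b').symm))
    simpa using this
  refine ⟨fun i => Equiv.ofBijective (g i) (Finite.injective_iff_bijective.mp (hinj i)),
    Equiv.ext ?_⟩
  rintro ⟨i, b⟩
  exact (hg i b).symm

/-- The centralizer of a sum of permutations `(c, a) ↦ (c, a + 1)` is the product of their
centralizers. -/
noncomputable def piCentralizerEquiv {I : Finset ℕ} (hI : ∀ i ∈ I, 1 ≤ i) (κ : I → Type*)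
    [∀ i, Finite (κ i)] :
    (∀ i : I, Subgroup.centralizer {cyclicShift (κ i) i}) ≃*
      Subgroup.centralizer {sigmaShift κ} :=
  MulEquiv.ofBijective
    (((Equiv.Perm.sigmaCongrRightHom fun i : I => κ i × ZMod i).comp
      (MonoidHom.pi fun i => (Subgroup.subtype _).comp
        (Pi.evalMonoidHom (fun i : I => Subgroup.centralizer {cyclicShift (κ i) (i : ℕ)})
          i))).codRestrict
      (Subgroup.centralizer {sigmaShift κ}) fun x => by
        rw [Subgroup.mem_centralizer_singleton_iff]
        refine Equiv.ext fun y => Sigma.ext rfl (heq_of_eq ?_)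
        exact DFunLike.congr_fun (Subgroup.mem_centralizer_singleton_iff.mp (x y.1).2) y.2)
    ⟨fun x x' h => by
      have := Equiv.Perm.sigmaCongrRightHom_injective (congrArg Subtype.val h)
      exact funext fun i => Subtype.ext (congrFun this i), by
      rintro ⟨z, hz⟩
      have hz' := Subgroup.mem_centralizer_singleton_iff.mp hz
      have hne : ∀ i : I, NeZero (i : ℕ) := fun i => ⟨by have := hI i i.2; omega⟩
      obtain ⟨g, rfl⟩ := z.exists_sigmaCongrRight_eq fun y => by
        -- A commuting `z` preserves periods, and the period of a point is the index of its summand.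
        refine Subtype.ext (Nat.dvd_right_iff_eq.mp fun k => ?_)
        have hk : Commute z (sigmaShift κ ^ k) := Commute.pow_right hz' k
        rw [← sigmaShift_pow_apply_eq_iff, ← sigmaShift_pow_apply_eq_iff,
          ← Equiv.Perm.mul_apply, ← hk.eq, Equiv.Perm.mul_apply, z.injective.eq_iff]
      refine ⟨fun i => ⟨g i, ?_⟩, rfl⟩
      rw [Subgroup.mem_centralizer_singleton_iff]
      refine Equiv.ext fun y => ?_
      have := DFunLike.congr_fun hz' ⟨i, y⟩
      exact eq_of_heq (Sigma.ext_iff.mp this).2⟩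

/-- Conjugate permutations have isomorphic centralizers. -/
def centralizerMulEquiv {G G' : Type*} [Group G] [Group G'] (e : G ≃* G') {x : G} {y : G'}
    (h : e x = y) : Subgroup.centralizer {x} ≃* Subgroup.centralizer {y} where
  toEquiv := e.toEquiv.subtypeEquiv fun z => by
    rw [Subgroup.mem_centralizer_singleton_iff, Subgroup.mem_centralizer_singleton_iff, ← h]
    simp only [MulEquiv.toEquiv_eq_coe, EquivLike.coe_coe, ← map_mul, e.injective.eq_iff]
  map_mul' z w := Subtype.ext (map_mul e _ _)

theorem card_linChar_centralizer {F : Type*} [Field F] {α : Type*} [Fintype α] [DecidableEq α]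
    {n : ℕ} (hn : Fintype.card α = n) (σ : Equiv.Perm α)
    (hroot : ∀ i, 1 ≤ σ.partition.parts.count i → ∃ ζ : F, IsPrimitiveRoot ζ i)
    (hneg : ∀ i, 2 ≤ σ.partition.parts.count i → (-1 : F) ≠ 1) :
    Nat.card (LinChar F (Subgroup.centralizer {σ})) =
      (∏ i ∈ Finset.Icc 1 n with σ.partition.parts.count i = 1, i) *
        ∏ i ∈ Finset.Icc 1 n with 2 ≤ σ.partition.parts.count i, 2 * i := by
  subst hn
  classical
  obtain ⟨κ, e, he⟩ := exists_equiv_sigmaShift σ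
  have hI : ∀ i ∈ Finset.Icc 1 (Fintype.card α), 1 ≤ i := fun i hi => (Finset.mem_Icc.mp hi).1
  have hne : ∀ i : Finset.Icc 1 (Fintype.card α), NeZero (i : ℕ) := fun i =>
    ⟨by have := hI i i.2; omega⟩
  have hκ : ∀ i, Finite (κ i) := fun i =>
    Finite.of_injective (fun c => e.symm ⟨i, c, 0⟩) fun c c' h => by
      simpa using e.symm.injective h
  have hcount := card_eq_count_of_equiv_sigmaShift hI e he
  have hconj : e.permCongrHom σ = sigmaShift κ := Equiv.ext fun y => by
    change e (σ (e.symm y)) = _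
    rw [← he, Equiv.apply_symm_apply]
  have E := (centralizerMulEquiv e.permCongrHom hconj).trans (piCentralizerEquiv hI κ).symm
  rw [LinChar, Nat.card_congr (MulEquiv.monoidHomCongrLeftEquiv E),
    Nat.card_congr (piMonoidHomEquiv _ _), Nat.card_pi]
  have : ∀ i : Finset.Icc 1 (Fintype.card α),
      Nat.card (Subgroup.centralizer {cyclicShift (κ i) (i : ℕ)} →* Fˣ) =
        (if σ.partition.parts.count (i : ℕ) = 1 then (i : ℕ) else 1) *
          if 2 ≤ σ.partition.parts.count (i : ℕ) then 2 * (i : ℕ) else 1 := fun i => by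
    have := card_monoidHom_centralizer_cyclicShift (F := F) (κ i) i
      (by rw [hcount]; exact hroot i) (by rw [hcount]; exact hneg i)
    rw [this, hcount]
  rw [Finset.prod_congr rfl fun i _ => this i, Finset.prod_filter, Finset.prod_filter,
    ← Finset.prod_mul_distrib]
  exact Finset.prod_coe_sort _ fun i : ℕ => (if σ.partition.parts.count i = 1 then i else 1) *
    if 2 ≤ σ.partition.parts.count i then 2 * i else 1

theorem theorem2p22 {F : Type*} [Field F] (n : ℕ) (hn : n ≠ 6)
    (r : Ramification (Equiv.Perm (Fin n)))
    (hroot : ∀ C, r C ≠ 0 → ∀ i, 1 ≤ cycleCount C i → ∃ ζ : F, IsPrimitiveRoot ζ i)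
    (hneg : ∀ C, r C ≠ 0 → ∀ i, 2 ≤ cycleCount C i → (-1 : F) ≠ 1) :
    (∀ C, r C ≠ 0 → ∀ σ ∈ C.carrier,
      Nat.card (LinChar F (Subgroup.centralizer {σ})) = gammaClass C) ∧
    RSC.numClasses F r =
      ∏ C : ConjClasses (Equiv.Perm (Fin n)) with r C ≠ 0,
        (gammaClass C + r C - 1).choose (r C) := by
  have hcard : ∀ C, r C ≠ 0 → ∀ σ ∈ C.carrier,
      Nat.card (LinChar F (Subgroup.centralizer {σ})) = gammaClass C := by
    intro C hC σ hσ
    obtain rfl := ConjClasses.mem_carrier_iff_mk_eq.mp hσ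
    exact card_linChar_centralizer (Fintype.card_fin n) σ (hroot _ hC) (hneg _ hC)
  refine ⟨hcard, ?_⟩
  rw [RSC.numClasses_eq_card_pi_sym
    (Equiv.Perm.exists_eq_conj (by rwa [Fintype.card_fin])) r Quotient.out
    fun C => ConjClasses.mem_carrier_iff_mk_eq.mpr (Quotient.out_eq C), Nat.card_pi,
    Finset.prod_filter]
  refine Finset.prod_congr rfl fun C _ => ?_
  rw [Sym.natCard_sym_eq_choose]
  split_ifs with hC
  · rw [hcard C hC _ (ConjClasses.mem_carrier_iff_mk_eq.mpr (Quotient.out_eq C))]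
  -- Nothing is known about the number of characters here, but there is just one empty multiset.
  · rw [not_not.mp hC, Nat.choose_zero_right]
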